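/- Let $\mathcal G=(\mathcal V,\mathcal E,\mathcal W)$ be a weighted signed digraph on $\mathcal V=\{1,\dots,N\}$ with real adjacency matrix $\mathcal W=[w_{ij}]$ such that $w_{ii}=0$ and $w_{ij}w_{ji}\ge 0$ for all $i,j$ (there is an edge from $j$ to $i$ iff $w_{ij}\ne0$), and let $\overline{\mathcal G}$ be its unsigned graph, with weights $\overline w_{ij}=|w_{ij}|$ and Laplacian $\overline L$, $\overline l_{ii}=\sum_j\overline w_{ij}$, $\overline l_{ij}=-\overline w_{ij}$ for $i\neq j$. Let $A,F\in\mathbf R^{n\times n}$, $0\le\sigma\le1$, $h>0$, $\Lambda=I_n-A$ and $\mathcal A=\sigma\Lambda+(1-\sigma)\mathrm e^{-Ah}\Lambda$. Assume that 1. $\overline{\mathcal G}$ is quasi-strongly connected, i.e. some node has directed paths to all other nodes; 2. $A\in\mathcal S$, i.e. every eigenvalue of $A$ has nonpositive real part, $A$ has at least one eigenvalue on the imaginary axis, and every eigenvalue of $A$ on the imaginary axis is semi-simple (its algebraic and geometric multiplicities are equal); 3. $A-\lambda_i\mathcal AF$ is Hurwitz (all its eigenvalues have negative real part) for $i=2,\dots,N$,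 where $\lambda_1=0,\lambda_2,\dots,\lambda_N$ are the eigenvalues of $\overline L$ counted with algebraic multiplicity. Consider any opinions $x_i:[0,\infty)\to\mathbf R^n$ and inputs $u_i:[-h,\infty)\to\mathbf R^n$, $i=1,\dots,N$, with $x_i$ locally absolutely continuous and $u_i$ locally integrable (the past inputs on $[-h,0)$ being arbitrary), that satisfy the opinion dynamics $$\dot x_i(t)=Ax_i(t)+\sigma\Lambda u_i(t)+(1-\sigma)\Lambda u_i(t-h)\qquad\text{for almost every } t\ge0,$$ and the communication rule with memory on the cooperative network $\overline{\mathcal G}$, $$u_i(t)=F\sum_{j=1}^N\overline w_{ij}\bigl(z_j(t)-z_i(t)\bigr)\qquad\text{for all } t\ge0,\qquad z_i(t)=x_i(t)+(1-\sigma)\int_{t-h}^{t}\mathrm e^{A(t-h-s)}\Lambda u_i(s)\,\mathrm ds .$$ Then the opinions achieve consensus: there is a function $x^*:[0,\infty)\to\mathbf R^n$ such that $\lim_{t\to\infty}\bigl(x_i(t)-x^*(t)\bigr)=0$ for every $i\in\{1,\dots,N\}$. -/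

import Mathlib

open MeasureTheory Filter Topology

/-- A weighted signed digraph on the vertex set `{1, …, N}`, given by its weighted adjacency
matrix. There is an edge from `j` to `i` iff `w i j ≠ 0`; the edge is cooperative if `w i j > 0`
and competitive if `w i j < 0`. There are no self-loops, and antiparallel edges never have
opposite signs (digon sign-symmetry). -/
structure SignedDigraph (N : ℕ) where
  /-- the weighted adjacency matrix -/
  w : Matrix (Fin N) (Fin N) ℝ
  diag_zero : ∀ i, w i i = 0
  digon : ∀ i j, 0 ≤ w i j * w j i

namespace SignedDigraph

variable {N : ℕ}

/-- The unsigned graph of a signed digraph, with weights `|w i j|`. -/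
def unsigned (G : SignedDigraph N) : SignedDigraph N where
  w := Matrix.of fun i j => |G.w i j|
  diag_zero := fun i => by simp [G.diag_zero i]
  digon := fun i j => mul_nonneg (abs_nonneg _) (abs_nonneg _)

/-- The Laplacian matrix: `l i i = ∑ j, |w i j|`, and `l i j = - w i j` for `i ≠ j`. -/
def laplacian (G : SignedDigraph N) : Matrix (Fin N) (Fin N) ℝ :=
  Matrix.of fun i j => if i = j then ∑ k, |G.w i k| else - G.w i j

/-- There is an edge from `j` to `i`. -/
def Edge (G : SignedDigraph N) (j i : Fin N) : Prop := G.w i j ≠ 0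

/-- Some node has directed paths to all other nodes (an oriented spanning tree exists). -/
def QuasiStronglyConnected (G : SignedDigraph N) : Prop :=
  ∃ r : Fin N, ∀ i : Fin N, i ≠ r → Relation.TransGen G.Edge r i

/-- The eigenvalues `λ₂, …, λ_N` of the Laplacian: all its complex eigenvalues, repeated according
to algebraic multiplicity, except for one copy of the eigenvalue `λ₁ = 0`. -/
noncomputable def otherEigenvalues (G : SignedDigraph N) : Multiset ℂ :=
  (G.laplacian.map (algebraMap ℝ ℂ)).charpoly.roots.erase 0

end SignedDigraph

/-- A complex square matrix is Hurwitz if all its eigenvalues have negative real part. -/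
def IsHurwitz {n : ℕ} (M : Matrix (Fin n) (Fin n) ℂ) : Prop :=
  ∀ s ∈ spectrum ℂ M, s.re < 0

/-- The eigenvalue `s` of `M` is semi-simple: its algebraic and geometric multiplicities agree. -/
def IsSemisimpleEigenvalue {n : ℕ} (M : Matrix (Fin n) (Fin n) ℂ) (s : ℂ) : Prop :=
  M.charpoly.rootMultiplicity s =
    Module.finrank ℂ (Module.End.eigenspace (Matrix.toLin' M) s)

/-- The set `𝒮` of real square matrices whose eigenvalues all lie in the closed left half plane,
which have at least one eigenvalue on the imaginary axis, and all of whose eigenvalues on the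
imaginary axis are semi-simple. -/
def marginallyStableMatrices (n : ℕ) : Set (Matrix (Fin n) (Fin n) ℝ) :=
  {S | (∀ s ∈ spectrum ℂ (S.map (algebraMap ℝ ℂ)), s.re ≤ 0) ∧
    (∃ s ∈ spectrum ℂ (S.map (algebraMap ℝ ℂ)), s.re = 0) ∧
    ∀ s ∈ spectrum ℂ (S.map (algebraMap ℝ ℂ)), s.re = 0 →
      IsSemisimpleEigenvalue (S.map (algebraMap ℝ ℂ)) s}

section Dynamics

variable {N n : ℕ}

/-- The matrix `𝒜 = σ Λ + (1 - σ) e^{-Ah} Λ`, where `Λ = I - A`. -/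
noncomputable def effectiveInputMatrix (A : Matrix (Fin n) (Fin n) ℝ) (σ h : ℝ) :
    Matrix (Fin n) (Fin n) ℝ :=
  σ • (1 - A) + (1 - σ) • (NormedSpace.exp (-(h • A)) * (1 - A))

/-- The state
`z i t = x i t + (1 - σ) ∫_{t-h}^{t} e^{A(t-h-s)} Λ (u i s) ds`, where `Λ = I - A`. -/
noncomputable def memoryState (A : Matrix (Fin n) (Fin n) ℝ) (σ h : ℝ)
    (x u : Fin N → ℝ → Fin n → ℝ) (i : Fin N) (t : ℝ) : Fin n → ℝ :=
  x i t + (1 - σ) • ∫ s in (t - h)..t,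
    (NormedSpace.exp ((t - h - s) • A) * (1 - A)).mulVec (u i s)

/-- The opinions `x i : [0, ∞) → ℝⁿ` and the inputs `u i : [-h, ∞) → ℝⁿ` satisfy
`ẋ i t = A (x i t) + σ Λ (u i t) + (1 - σ) Λ (u i (t - h))`, `Λ = I - A`, for `t ≥ 0`.
The past inputs on `[-h, 0)` are arbitrary integrable initial data (which need not match the
inputs after time `0`), so solutions are understood in the sense of Carathéodory: `x i` is locally
absolutely continuous and satisfies the equation at almost every time. -/
structure IsOpinionDynamics (A : Matrix (Fin n) (Fin n) ℝ) (σ h : ℝ)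
    (x u : Fin N → ℝ → Fin n → ℝ) : Prop where
  input_integrable : ∀ i, ∀ T, 0 ≤ T → IntervalIntegrable (u i) volume (-h) T
  absolutelyContinuous : ∀ i, ∀ T, 0 ≤ T → AbsolutelyContinuousOnInterval (x i) 0 T
  deriv_eq : ∀ i, ∀ᵐ t ∂(volume.restrict (Set.Ici (0 : ℝ))),
    HasDerivAt (x i)
      (A.mulVec (x i t) + σ • (1 - A).mulVec (u i t) + (1 - σ) • (1 - A).mulVec (u i (t - h))) t

/-- The communication rule with memory, in force from time `0` on:
`u i t = F ∑ j, |w i j| (sgn (w i j) z j t - z i t)`. -/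
def FollowsMemoryRule (G : SignedDigraph N) (A F : Matrix (Fin n) (Fin n) ℝ) (σ h : ℝ)
    (x u : Fin N → ℝ → Fin n → ℝ) : Prop :=
  ∀ i, ∀ t, 0 ≤ t → u i t = F.mulVec (∑ j, |G.w i j| •
    (Real.sign (G.w i j) • memoryState A σ h x u j t - memoryState A σ h x u i t))

/-- Consensus: all opinions approach one common, possibly time-varying, opinion `x*`. -/
def ReachesConsensus (x : Fin N → ℝ → Fin n → ℝ) : Prop :=
  ∃ xstar : ℝ → Fin n → ℝ, ∀ i, Tendsto (fun t => x i t - xstar t) atTop (𝓝 0)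

end Dynamics

/-! Adding the distributed past input to the state removes the delay: `memoryState_hasDerivAt` gives
z_i' = A z_i + 𝒜 u_i, so the rule closes the loop as z_i' = A z_i - 𝒜F ∑ l_ij z_j.

No Jordan form is needed to decouple this network. The characteristic polynomial of the Laplacian L
is X ∏_{i≥2} (X - λ_i), so by Cayley–Hamilton ∏_{i≥2} (L - λ_i) annihilates Lz. The factors are
peeled off one at a time (`tendsto_zero_of_prod_mul`): once (L - λ)W vanishes in the limit, each row
of W solves a system with the Hurwitz matrix A - λ𝒜F and vanishing forcing. Hence Lz → 0
(`tendsto_laplacian_smul_zero`). The same peeling inside ℂⁿ reduces Hurwitz systems to scalar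
equations.

Now Lz → 0 forces u → 0. It also forces z_i - z_r → 0 for a root r, since ker L consists of constant
vectors. Finally z_i - x_i → 0, an integral of a vanishing input over a window of fixed length. So
x* = x_r works. -/

/-! ### Stability of linear systems under vanishing forcing -/

/-- A stable scalar linear equation with vanishing input has only vanishing solutions. -/
theorem tendsto_zero_of_hasDerivAt_smul_add {V : Type*} [NormedAddCommGroup V] [NormedSpace ℂ V]
    {μ : ℂ} (hμ : μ.re < 0) {y f : ℝ → V}
    (hy : ∀ t, 0 < t → HasDerivAt y (μ • y t + f t) t) (hf : Tendsto f atTop (𝓝 0)) :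
    Tendsto y atTop (𝓝 0) := by
  set a : ℝ := -μ.re with ha
  have ha0 : 0 < a := by simp [ha, hμ]
  have hE : ∀ t : ℝ, HasDerivAt (fun t : ℝ => Complex.exp (-μ * t))
      (Complex.exp (-μ * t) * -μ) t := by
    intro t
    have h1 : HasDerivAt (fun t : ℝ => -μ * (t : ℂ)) (-μ) t := by
      simpa using (Complex.ofRealCLM.hasDerivAt (x := t)).const_mul (-μ)
    exact h1.cexp
  -- Integrating factor: the term in μ cancels.
  have hG : ∀ t : ℝ, 0 < t → HasDerivAt (fun t : ℝ => Complex.exp (-μ * t) • y t)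
      (Complex.exp (-μ * t) • f t) t := by
    intro t ht
    refine ((hE t).smul (hy t ht)).congr_deriv ?_
    rw [smul_add, smul_smul]
    module
  have hnorm : ∀ t : ℝ, ‖Complex.exp (-μ * t)‖ = Real.exp (a * t) := by
    intro t
    rw [Complex.norm_exp]
    simp [ha]
  rw [Metric.tendsto_atTop]
  intro ε hε
  obtain ⟨T₀, hT₀⟩ := Metric.tendsto_atTop.1 hf (a * (ε / 2)) (by positivity)
  set T := max T₀ 1 with hT
  have hTpos : 0 < T := lt_of_lt_of_le one_pos (le_max_right _ _)
  set C := ‖Complex.exp (-μ * T) • y T‖ with hC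
  have hbound : ∀ t, T ≤ t → ‖y t‖ ≤ C * Real.exp (-(a * t)) + ε / 2 := by
    intro t ht
    have hB : ∀ s : ℝ, HasDerivAt
        (fun s => C + ε / 2 * (Real.exp (a * s) - Real.exp (a * T)))
        (ε / 2 * (Real.exp (a * s) * a)) s := by
      intro s
      have h1 : HasDerivAt (fun s : ℝ => a * s) a s := by
        simpa using (hasDerivAt_id s).const_mul a
      exact ((h1.exp.sub_const _).const_mul _).const_add _
    -- Past T the forcing is below a ε/2, so the norm of the derivative is at most that of the
    -- comparison function in `hB`, which starts at C.
    have key := image_norm_le_of_norm_deriv_right_le_deriv_boundary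
      (f := fun t : ℝ => Complex.exp (-μ * t) • y t) (a := T) (b := t)
      (fun s hs => (hG s (hTpos.trans_le hs.1)).continuousAt.continuousWithinAt)
      (fun s hs => (hG s (hTpos.trans_le hs.1)).hasDerivWithinAt)
      (by simp [hC]) hB (by
        intro s hs
        rw [norm_smul, hnorm]
        have := (hT₀ s ((le_max_left _ _).trans hs.1)).le
        rw [dist_zero_right] at this
        nlinarith [Real.exp_pos (a * s)]) (x := t) ⟨ht, le_rfl⟩
    have key : ‖Complex.exp (-μ * t) • y t‖ ≤
        C + ε / 2 * (Real.exp (a * t) - Real.exp (a * T)) := key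
    rw [norm_smul, hnorm] at key
    have h2 : Real.exp (-(a * t)) * Real.exp (a * t) = 1 := by
      rw [← Real.exp_add]; simp
    have h3 : ‖y t‖ = Real.exp (-(a * t)) * (Real.exp (a * t) * ‖y t‖) := by
      rw [← mul_assoc, h2, one_mul]
    rw [h3]
    calc _ ≤ Real.exp (-(a * t)) * (C + ε / 2 * (Real.exp (a * t) - Real.exp (a * T))) := by
          gcongr
      _ = C * Real.exp (-(a * t)) + ε / 2 * (Real.exp (-(a * t)) * Real.exp (a * t))
          - ε / 2 * (Real.exp (-(a * t)) * Real.exp (a * T)) := by ring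
      _ ≤ _ := by
          rw [h2, mul_one]
          have : 0 ≤ ε / 2 * (Real.exp (-(a * t)) * Real.exp (a * T)) := by positivity
          linarith
  have hlim : Tendsto (fun t : ℝ => C * Real.exp (-(a * t))) atTop (𝓝 0) := by
    have : Tendsto (fun t : ℝ => Real.exp (-(a * t))) atTop (𝓝 0) :=
      Real.tendsto_exp_neg_atTop_nhds_zero.comp (tendsto_id.const_mul_atTop ha0)
    simpa using this.const_mul C
  obtain ⟨T₁, hT₁⟩ := Metric.tendsto_atTop.1 hlim (ε / 2) (by positivity)
  refine ⟨max T T₁, fun t ht => ?_⟩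
  have h1 := hbound t ((le_max_left _ _).trans ht)
  have h2 := hT₁ t ((le_max_right _ _).trans ht)
  rw [Real.dist_0_eq_abs] at h2
  rw [dist_zero_right]
  linarith [le_abs_self (C * Real.exp (-(a * t)))]

theorem hasDerivAt_mulVec {m n : ℕ} (M : Matrix (Fin m) (Fin n) ℂ) {y : ℝ → Fin n → ℂ}
    {y' : Fin n → ℂ} {t : ℝ} (hy : HasDerivAt y y' t) :
    HasDerivAt (fun t => M.mulVec (y t)) (M.mulVec y') t :=
  ((M.mulVecLin.restrictScalars ℝ).toContinuousLinearMap).hasFDerivAt.comp_hasDerivAt t hy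

theorem tendsto_mulVec_zero {𝕜 : Type*} [RCLike 𝕜] {m n : ℕ} (M : Matrix (Fin m) (Fin n) 𝕜)
    {y : ℝ → Fin n → 𝕜} (hy : Tendsto y atTop (𝓝 0)) :
    Tendsto (fun t => M.mulVec (y t)) atTop (𝓝 0) := by
  have h := ((Continuous.matrix_mulVec (continuous_const (y := M)) continuous_id).tendsto
    (0 : Fin n → 𝕜)).comp hy
  rw [id, Matrix.mulVec_zero] at h
  exact h

/-- Induction on the factors: (M - μ)y solves the same system with forcing (M - μ)g, so it vanishes
in the limit by induction. Then y' = μ y + ((M - μ)y + g) is a stable scalar equation. -/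
theorem tendsto_zero_of_prod_mulVec {n : ℕ} (M : Matrix (Fin n) (Fin n) ℂ) (s : Multiset ℂ)
    (hs : ∀ μ ∈ s, μ.re < 0) {y g : ℝ → Fin n → ℂ}
    (hy : ∀ t, 0 < t → HasDerivAt y (M.mulVec (y t) + g t) t) (hg : Tendsto g atTop (𝓝 0))
    (h0 : Tendsto (fun t => (Polynomial.aeval M
      (s.map fun μ => Polynomial.X - Polynomial.C μ).prod).mulVec (y t)) atTop (𝓝 0)) :
    Tendsto y atTop (𝓝 0) := by
  induction s using Multiset.induction_on generalizing y g with
  | empty => simpa using h0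
  | cons μ s ih =>
    have hw := ih (fun ν hν => hs ν (Multiset.mem_cons_of_mem hν))
      (y := fun t => (M - μ • 1).mulVec (y t)) (g := fun t => (M - μ • 1).mulVec (g t))
      (fun t ht => by
        refine (hasDerivAt_mulVec (M - μ • 1) (hy t ht)).congr_deriv ?_
        rw [Matrix.mulVec_add, Matrix.mulVec_mulVec, Matrix.mulVec_mulVec]
        simp [mul_sub, sub_mul])
      (tendsto_mulVec_zero _ hg)
      (by
        refine h0.congr fun t => ?_
        rw [Matrix.mulVec_mulVec, Multiset.map_cons, Multiset.prod_cons, mul_comm, map_mul]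
        simp [Algebra.algebraMap_eq_smul_one])
    refine tendsto_zero_of_hasDerivAt_smul_add (hs μ (Multiset.mem_cons_self _ _))
      (f := fun t => (M - μ • 1).mulVec (y t) + g t) (fun t ht => ?_)
      (by simpa using hw.add hg)
    refine (hy t ht).congr_deriv ?_
    rw [Matrix.sub_mulVec, Matrix.smul_mulVec, Matrix.one_mulVec]
    abel

theorem charpoly_eq_prod_roots {n : ℕ} (M : Matrix (Fin n) (Fin n) ℂ) :
    (M.charpoly.roots.map fun μ => Polynomial.X - Polynomial.C μ).prod = M.charpoly :=
  ((IsAlgClosed.splits M.charpoly).eq_prod_roots_of_monic M.charpoly_monic).symm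

/-- A Hurwitz linear system with vanishing input has only vanishing solutions. -/
theorem IsHurwitz.tendsto_zero {n : ℕ} {M : Matrix (Fin n) (Fin n) ℂ} (hM : IsHurwitz M)
    {y g : ℝ → Fin n → ℂ} (hy : ∀ t, 0 < t → HasDerivAt y (M.mulVec (y t) + g t) t)
    (hg : Tendsto g atTop (𝓝 0)) : Tendsto y atTop (𝓝 0) := by
  refine tendsto_zero_of_prod_mulVec M M.charpoly.roots (fun μ hμ => hM μ ?_) hy hg ?_
  · exact Matrix.mem_spectrum_of_isRoot_charpoly (Polynomial.isRoot_of_mem_roots hμ)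
  · rw [charpoly_eq_prod_roots, Matrix.aeval_self_charpoly]
    simp

/-! ### Networked systems, one agent per matrix row -/

theorem mul_row_eq_sum {m n : ℕ} (P : Matrix (Fin m) (Fin m) ℂ) (W : Matrix (Fin m) (Fin n) ℂ)
    (i : Fin m) : (P * W) i = ∑ j, P i j • W j := by
  ext k
  simp [Matrix.mul_apply]

theorem mul_mul_transpose_row {m n : ℕ} (W : Matrix (Fin m) (Fin n) ℂ)
    (A : Matrix (Fin n) (Fin n) ℂ) (i : Fin m) : (W * A.transpose) i = A.mulVec (W i) := by
  ext k
  simp [Matrix.mul_apply, Matrix.mulVec, dotProduct, mul_comm]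

/-- The networked system obtained by acting on all agents by a matrix commuting with the
coupling matrix solves the same equation. -/
theorem hasDerivAt_mul_row {m n : ℕ} {L P : Matrix (Fin m) (Fin m) ℂ} (hP : Commute P L)
    {A B : Matrix (Fin n) (Fin n) ℂ} {W : ℝ → Matrix (Fin m) (Fin n) ℂ} {t : ℝ}
    (hW : ∀ i, HasDerivAt (fun t => W t i) (A.mulVec (W t i) - B.mulVec ((L * W t) i)) t)
    (i : Fin m) : HasDerivAt (fun t => (P * W t) i)
      (A.mulVec ((P * W t) i) - B.mulVec ((L * (P * W t)) i)) t := by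
  simp only [mul_row_eq_sum P]
  refine (HasDerivAt.fun_sum (u := Finset.univ)
    fun j _ => (hW j).const_smul (P i j)).congr_deriv ?_
  have h : P * (W t * A.transpose - L * W t * B.transpose) =
      P * W t * A.transpose - L * (P * W t) * B.transpose := by
    rw [Matrix.mul_sub, ← Matrix.mul_assoc P, ← Matrix.mul_assoc P, ← Matrix.mul_assoc P,
      hP.eq, Matrix.mul_assoc L P]
  have h' := congrFun h i
  rw [mul_row_eq_sum P] at h'
  have hrow : ∀ j, (W t * A.transpose - L * W t * B.transpose) j =
      A.mulVec (W t j) - B.mulVec ((L * W t) j) := by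
    intro j
    rw [← mul_mul_transpose_row, ← mul_mul_transpose_row]
    rfl
  simp only [hrow] at h'
  rw [h', ← mul_row_eq_sum P, ← mul_mul_transpose_row, ← mul_mul_transpose_row]
  rfl

/-- Modes of a networked linear system whose decoupled systems are all Hurwitz vanish. -/
theorem tendsto_zero_of_prod_mul {m n : ℕ} (L : Matrix (Fin m) (Fin m) ℂ)
    (A B : Matrix (Fin n) (Fin n) ℂ) (s : Multiset ℂ) (hs : ∀ l ∈ s, IsHurwitz (A - l • B))
    {W : ℝ → Matrix (Fin m) (Fin n) ℂ}
    (hW : ∀ i t, 0 < t →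
      HasDerivAt (fun t => W t i) (A.mulVec (W t i) - B.mulVec ((L * W t) i)) t)
    (h0 : ∀ i, Tendsto (fun t => ((Polynomial.aeval L
      (s.map fun l => Polynomial.X - Polynomial.C l).prod) * W t) i) atTop (𝓝 0)) (i : Fin m) :
    Tendsto (fun t => W t i) atTop (𝓝 0) := by
  induction s using Multiset.induction_on generalizing W i with
  | empty => simpa using h0 i
  | cons l s ih =>
    have hcomm : Commute (L - l • 1) L :=
      (Commute.refl L).sub_left ((Commute.one_left L).smul_left l)
    have hw := ih (fun ν hν => hs ν (Multiset.mem_cons_of_mem hν))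
      (W := fun t => (L - l • (1 : Matrix (Fin m) (Fin m) ℂ)) * W t)
      (fun i t ht => hasDerivAt_mul_row hcomm (fun i => hW i t ht) i)
      (fun i => by
        refine (h0 i).congr fun t => ?_
        rw [← Matrix.mul_assoc, Multiset.map_cons, Multiset.prod_cons, mul_comm, map_mul]
        simp [Algebra.algebraMap_eq_smul_one])
    -- Writing L W = l W + (L - l)W isolates the Hurwitz matrix A - l B; the rest is forcing that
    -- vanishes by induction.
    refine (hs l (Multiset.mem_cons_self _ _)).tendsto_zero
      (g := fun t => -B.mulVec (((L - l • (1 : Matrix (Fin m) (Fin m) ℂ)) * W t) i)) (fun t ht => ?_)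
      (by simpa using (tendsto_mulVec_zero B (hw i)).neg)
    refine (hW i t ht).congr_deriv ?_
    have : ((L - l • (1 : Matrix (Fin m) (Fin m) ℂ)) * W t) i = (L * W t) i - l • W t i := by
      rw [Matrix.sub_mul, Matrix.smul_mul, Matrix.one_mul]
      rfl
    rw [this, Matrix.mulVec_sub, Matrix.sub_mulVec, Matrix.smul_mulVec, Matrix.mulVec_smul]
    abel

/-! ### The Laplacian of the unsigned graph -/

namespace SignedDigraph

theorem laplacian_apply {N : ℕ} (G : SignedDigraph N) (i j : Fin N) :
    G.laplacian i j = (if i = j then ∑ k, |G.w i k| else 0) - G.w i j := by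
  unfold laplacian
  by_cases h : i = j
  · subst h; simp [G.diag_zero]
  · simp [h]

theorem sum_laplacian_smul {N : ℕ} (G : SignedDigraph N) {V : Type*} [AddCommGroup V]
    [Module ℝ V] (z : Fin N → V) (i : Fin N) :
    ∑ j, |G.unsigned.w i j| • (Real.sign (G.unsigned.w i j) • z j - z i) =
      -∑ j, G.unsigned.laplacian i j • z j := by
  have h : ∀ j, |G.unsigned.w i j| • (Real.sign (G.unsigned.w i j) • z j - z i) =
      G.unsigned.w i j • z j - |G.unsigned.w i j| • z i := by
    intro j
    have h0 : 0 ≤ G.unsigned.w i j := abs_nonneg _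
    rw [smul_sub, smul_smul, abs_of_nonneg h0]
    rcases h0.eq_or_lt with h1 | h1
    · simp [← h1]
    · rw [Real.sign_of_pos h1, mul_one]
  simp only [h, laplacian_apply, sub_smul, ite_smul, zero_smul, Finset.sum_sub_distrib,
    Finset.sum_ite_eq, Finset.mem_univ, if_true, Finset.sum_smul]
  abel

theorem laplacian_mulVec_one {N : ℕ} (G : SignedDigraph N) :
    G.unsigned.laplacian.mulVec 1 = 0 := by
  ext i
  have h : ∀ j, |G.unsigned.w i j| = G.unsigned.w i j := fun j => abs_of_nonneg (abs_nonneg _)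
  simp [Matrix.mulVec, dotProduct, laplacian_apply, Finset.sum_sub_distrib, h]

/-- A maximal value of a vector in the kernel of the Laplacian is attained at the root. -/
theorem le_root_of_laplacian_mulVec_eq_zero {N : ℕ} (G : SignedDigraph N) {r : Fin N}
    (hr : ∀ i, i ≠ r → Relation.TransGen G.unsigned.Edge r i) {v : Fin N → ℝ}
    (hv : G.unsigned.laplacian.mulVec v = 0) (i : Fin N) : v i ≤ v r := by
  have hw : ∀ i j, 0 ≤ G.unsigned.w i j := fun i j => abs_nonneg _
  have : Nonempty (Fin N) := ⟨i⟩
  obtain ⟨m, hm⟩ := Finite.exists_max v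
  have step : ∀ a b, G.unsigned.Edge a b → v b = v m → v a = v m := by
    intro a b hab hb
    -- At a maximum every summand is nonnegative, so every in-neighbour of b also attains it; the
    -- maximum travels back along paths to r.
    have h0 : ∑ j, G.unsigned.w b j * (v b - v j) = 0 := by
      have h1 := congrFun hv b
      have h2 : ∀ j, |G.unsigned.w b j| = G.unsigned.w b j := fun j => abs_of_nonneg (hw b j)
      simpa [Matrix.mulVec, dotProduct, laplacian_apply, sub_mul, Finset.sum_sub_distrib, mul_sub,
        ← Finset.sum_mul, h2] using h1
    have h3 := (Finset.sum_eq_zero_iff_of_nonneg fun j _ =>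
      mul_nonneg (hw b j) (by rw [hb]; linarith [hm j])).1 h0 a (Finset.mem_univ _)
    rcases mul_eq_zero.1 h3 with h4 | h4
    · exact absurd h4 hab
    · linarith
  have hroot : v r = v m := by
    by_cases hmr : m = r
    · rw [hmr]
    · have hall : ∀ b, Relation.TransGen G.unsigned.Edge r b → v b = v m → v r = v m := by
        intro b hb
        induction hb with
        | single h => exact step _ _ h
        | tail _ h ih => exact fun hc => ih (step _ _ h hc)
      exact hall m (hr m hmr) rfl
  rw [hroot]
  exact hm i

theorem eq_root_of_laplacian_mulVec_eq_zero {N : ℕ} (G : SignedDigraph N) {r : Fin N}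
    (hr : ∀ i, i ≠ r → Relation.TransGen G.unsigned.Edge r i) {v : Fin N → ℝ}
    (hv : G.unsigned.laplacian.mulVec v = 0) (i : Fin N) : v i = v r := by
  refine le_antisymm (G.le_root_of_laplacian_mulVec_eq_zero hr hv i) ?_
  have h := G.le_root_of_laplacian_mulVec_eq_zero hr (v := -v) (by simp [Matrix.mulVec_neg, hv]) i
  simpa using h

/-- In a quasi-strongly connected graph, disagreements are linear in the image of the
Laplacian. -/
theorem exists_sub_eq_sum_laplacian {N : ℕ} (G : SignedDigraph N) {r : Fin N}
    (hr : ∀ i, i ≠ r → Relation.TransGen G.unsigned.Edge r i) (i : Fin N) :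
    ∃ c : Fin N → ℝ, ∀ v : Fin N → ℝ,
      v i - v r = ∑ k, c k * G.unsigned.laplacian.mulVec v k := by
  have h : ((LinearMap.proj i : (Fin N → ℝ) →ₗ[ℝ] ℝ) - LinearMap.proj r) ∈
      Submodule.span ℝ (Set.range fun k =>
        (LinearMap.proj k : (Fin N → ℝ) →ₗ[ℝ] ℝ) ∘ₗ G.unsigned.laplacian.mulVecLin) := by
    -- By duality, a functional vanishing on the common kernel of the rows of the Laplacian is a
    -- combination of these rows.
    refine mem_span_of_iInf_ker_le_ker fun v hv => ?_
    have hv0 : G.unsigned.laplacian.mulVec v = 0 := by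
      ext k
      simpa using (Submodule.mem_iInf _).1 hv k
    simpa [sub_eq_zero] using G.eq_root_of_laplacian_mulVec_eq_zero hr hv0 i
  obtain ⟨c, hc⟩ := (Submodule.mem_span_range_iff_exists_fun ℝ).1 h
  refine ⟨c, fun v => ?_⟩
  have := LinearMap.congr_fun hc v
  simpa using this.symm

/-- Ensures that `otherEigenvalues` really removes one root. -/
theorem zero_mem_roots_charpoly_laplacian {N : ℕ} [NeZero N] (G : SignedDigraph N) :
    (0 : ℂ) ∈ (G.unsigned.laplacian.map (algebraMap ℝ ℂ)).charpoly.roots := by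
  have h : G.unsigned.laplacian.det = 0 :=
    Matrix.exists_mulVec_eq_zero_iff.1 ⟨1, one_ne_zero, G.laplacian_mulVec_one⟩
  have h' : (G.unsigned.laplacian.map (algebraMap ℝ ℂ)).det = 0 := by
    have := (RingHom.map_det (algebraMap ℝ ℂ) G.unsigned.laplacian).symm
    rwa [h, map_zero] at this
  rw [Polynomial.mem_roots (Matrix.charpoly_monic _).ne_zero, Polynomial.IsRoot,
    Matrix.eval_charpoly]
  rw [map_zero, zero_sub, Matrix.det_neg, h', mul_zero]

end SignedDigraph

/-- Diffusively coupled linear systems whose decoupled systems, except for the one belonging to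
the trivial Laplacian eigenvalue, are Hurwitz, reach agreement: the coupling terms vanish. -/
theorem tendsto_laplacian_smul_zero {N n : ℕ} (G : SignedDigraph N)
    (A B : Matrix (Fin n) (Fin n) ℝ)
    (hF : ∀ l ∈ G.unsigned.otherEigenvalues,
      IsHurwitz (A.map (algebraMap ℝ ℂ) - l • B.map (algebraMap ℝ ℂ)))
    {z : Fin N → ℝ → Fin n → ℝ}
    (hz : ∀ i t, 0 < t → HasDerivAt (z i)
      (A.mulVec (z i t) - B.mulVec (∑ j, G.unsigned.laplacian i j • z j t)) t) (i : Fin N) :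
    Tendsto (fun t => ∑ j, G.unsigned.laplacian i j • z j t) atTop (𝓝 0) := by
  have : NeZero N := ⟨fun h => (h ▸ i).elim0⟩
  set Lc := G.unsigned.laplacian.map (algebraMap ℝ ℂ) with hLc
  let W : ℝ → Matrix (Fin N) (Fin n) ℂ := fun t i k => (z i t k : ℂ)
  have hLW : ∀ i t k, (Lc * W t) i k =
      (((∑ j, G.unsigned.laplacian i j • z j t) k : ℝ) : ℂ) := by
    intro i t k
    rw [Matrix.mul_apply]
    simp [hLc, W]
  have hmul : ∀ (M : Matrix (Fin n) (Fin n) ℝ) (v : Fin n → ℝ) k,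
      (M.map (algebraMap ℝ ℂ)).mulVec (fun k => (v k : ℂ)) k = ((M.mulVec v k : ℝ) : ℂ) := by
    intro M v k
    simp [Matrix.mulVec, dotProduct]
  have hW : ∀ i t, 0 < t → HasDerivAt (fun t => W t i)
      ((A.map (algebraMap ℝ ℂ)).mulVec (W t i)
        - (B.map (algebraMap ℝ ℂ)).mulVec ((Lc * W t) i)) t := by
    intro i t ht
    rw [hasDerivAt_pi]
    intro k
    refine ((hasDerivAt_pi.1 (hz i t ht) k).ofReal_comp).congr_deriv ?_
    have h1 : (Lc * W t) i = fun k =>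
        (((∑ j, G.unsigned.laplacian i j • z j t) k : ℝ) : ℂ) := funext (hLW i t)
    rw [h1, Pi.sub_apply, Pi.sub_apply, hmul, Complex.ofReal_sub, ← hmul A (z i t) k,
      ← hmul B (∑ j, G.unsigned.laplacian i j • z j t) k]
  -- Applied to L W instead of W: the missing factor X of the characteristic polynomial is supplied
  -- by L.
  have hlim := tendsto_zero_of_prod_mul Lc (A.map (algebraMap ℝ ℂ)) (B.map (algebraMap ℝ ℂ))
    G.unsigned.otherEigenvalues hF (W := fun t => Lc * W t)
    (fun i t ht => hasDerivAt_mul_row (Commute.refl Lc) (fun i => hW i t ht) i)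
    (fun i => by
      have h0 : Polynomial.aeval Lc (G.unsigned.otherEigenvalues.map
          fun l => Polynomial.X - Polynomial.C l).prod * Lc = 0 := by
        have h1 := charpoly_eq_prod_roots Lc
        rw [← Multiset.cons_erase G.zero_mem_roots_charpoly_laplacian, Multiset.map_cons,
          Multiset.prod_cons, map_zero, sub_zero, mul_comm] at h1
        have h2 := congrArg (Polynomial.aeval Lc) h1
        rw [Matrix.aeval_self_charpoly, map_mul, Polynomial.aeval_X] at h2
        exact h2
      simp only [← Matrix.mul_assoc, h0, Matrix.zero_mul]
      exact tendsto_const_nhds) i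
  rw [tendsto_pi_nhds] at hlim ⊢
  intro k
  have h := (Complex.continuous_re.tendsto _).comp (hlim k)
  simpa [Function.comp_def, hLW] using h

/-! ### Calculus of matrix exponentials and absolutely continuous functions -/

open scoped Matrix.Norms.Operator in
theorem hasDerivAt_exp_smul_apply {n : ℕ} (A : Matrix (Fin n) (Fin n) ℝ) (i j : Fin n) (t : ℝ) :
    HasDerivAt (fun t : ℝ => NormedSpace.exp (t • A) i j)
      ((A * NormedSpace.exp (t • A)) i j) t :=
  ((Matrix.entryLinearMap ℝ ℝ i j).toContinuousLinearMap).hasFDerivAt.comp_hasDerivAt t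
    (hasDerivAt_exp_smul_const' A t)

theorem continuous_exp_smul {n : ℕ} (A : Matrix (Fin n) (Fin n) ℝ) :
    Continuous fun t : ℝ => NormedSpace.exp (t • A) :=
  continuous_matrix fun i j => continuous_iff_continuousAt.2 fun t =>
    (hasDerivAt_exp_smul_apply A i j t).continuousAt

theorem contDiff_exp_smul_apply {n : ℕ} (A : Matrix (Fin n) (Fin n) ℝ) (i j : Fin n) :
    ContDiff ℝ 1 fun t : ℝ => NormedSpace.exp (t • A) i j := by
  refine contDiff_one_iff_deriv.2
    ⟨fun t => (hasDerivAt_exp_smul_apply A i j t).differentiableAt, ?_⟩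
  have h : deriv (fun t : ℝ => NormedSpace.exp (t • A) i j) =
      fun t => (A * NormedSpace.exp (t • A)) i j :=
    funext fun t => (hasDerivAt_exp_smul_apply A i j t).deriv
  rw [h]
  exact (continuous_const.matrix_mul (continuous_exp_smul A)).matrix_elem i j

theorem mulVec_eq_sum_smul_col {m n : ℕ} (M : Matrix (Fin m) (Fin n) ℝ) (v : Fin n → ℝ) :
    M.mulVec v = ∑ j, v j • fun i => M i j := by
  ext i
  simp [Matrix.mulVec, dotProduct, mul_comm]

theorem HasDerivAt.matrix_mulVec {m n : ℕ} {M : ℝ → Matrix (Fin m) (Fin n) ℝ}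
    {M' : Matrix (Fin m) (Fin n) ℝ} {v : ℝ → Fin n → ℝ} {v' : Fin n → ℝ} {t : ℝ}
    (hM : ∀ i j, HasDerivAt (fun t => M t i j) (M' i j) t) (hv : HasDerivAt v v' t) :
    HasDerivAt (fun t => (M t).mulVec (v t)) (M'.mulVec (v t) + (M t).mulVec v') t := by
  simp only [mulVec_eq_sum_smul_col (M _)]
  refine (HasDerivAt.fun_sum (u := Finset.univ) fun j _ =>
    (hasDerivAt_pi.1 hv j).smul (hasDerivAt_pi.2 fun i => hM i j)).congr_deriv ?_
  simp only [mulVec_eq_sum_smul_col, Finset.sum_add_distrib]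

theorem AbsolutelyContinuousOnInterval.finset_sum {E ι : Type*} [NormedAddCommGroup E]
    {a b : ℝ} (s : Finset ι) {f : ι → ℝ → E}
    (hf : ∀ i ∈ s, AbsolutelyContinuousOnInterval (f i) a b) :
    AbsolutelyContinuousOnInterval (fun t => ∑ i ∈ s, f i t) a b := by
  classical
  induction s using Finset.induction_on with
  | empty =>
    simpa using (LipschitzWith.const (0 : E)).lipschitzOnWith.absolutelyContinuousOnInterval
  | insert i s hi ih =>
    simp only [Finset.sum_insert hi]
    exact (hf i (Finset.mem_insert_self _ _)).fun_add
      (ih fun j hj => hf j (Finset.mem_insert_of_mem hj))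

theorem AbsolutelyContinuousOnInterval.matrix_mulVec {m n : ℕ} {a b : ℝ}
    {M : ℝ → Matrix (Fin m) (Fin n) ℝ} {v : ℝ → Fin n → ℝ}
    (hM : ∀ j, AbsolutelyContinuousOnInterval (fun t i => M t i j) a b)
    (hv : ∀ j, AbsolutelyContinuousOnInterval (fun t => v t j) a b) :
    AbsolutelyContinuousOnInterval (fun t => (M t).mulVec (v t)) a b := by
  simp only [mulVec_eq_sum_smul_col]
  exact AbsolutelyContinuousOnInterval.finset_sum _ fun j _ => (hv j).fun_smul (hM j)

theorem IntervalIntegrable.eval {n : ℕ} {f : ℝ → Fin n → ℝ} {a b : ℝ}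
    (hf : IntervalIntegrable f volume a b) (i : Fin n) :
    IntervalIntegrable (fun t => f t i) volume a b :=
  ⟨Integrable.eval hf.1 i, Integrable.eval hf.2 i⟩

theorem intervalIntegral_apply {n : ℕ} {f : ℝ → Fin n → ℝ} {a b : ℝ}
    (hf : IntervalIntegrable f volume a b) (i : Fin n) :
    (∫ t in a..b, f t) i = ∫ t in a..b, f t i :=
  ((ContinuousLinearMap.proj (R := ℝ) (φ := fun _ : Fin n => ℝ) i).intervalIntegral_comp_comm
    hf).symm

theorem IntervalIntegrable.matrix_mulVec {m n : ℕ} {M : ℝ → Matrix (Fin m) (Fin n) ℝ}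
    {v : ℝ → Fin n → ℝ} {a b : ℝ} (hM : Continuous M) (hv : IntervalIntegrable v volume a b) :
    IntervalIntegrable (fun t => (M t).mulVec (v t)) volume a b := by
  simp only [mulVec_eq_sum_smul_col]
  have h := IntervalIntegrable.sum (μ := volume) (a := a) (b := b) Finset.univ
    (f := fun j t => v t j • fun i => M t i j) fun j _ =>
    (hv.eval j).smul_continuousOn
      (continuous_pi fun i => hM.matrix_elem i j).continuousOn
  have heq : (fun t => ∑ j, v t j • fun i => M t i j) =
      ∑ j, fun t => v t j • fun i => M t i j := by
    ext t
    simp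
  rwa [heq]

/-- An absolutely continuous function whose derivative almost everywhere equals a continuous
function is differentiable everywhere. -/
theorem hasDerivAt_of_ae_hasDerivAt {E : Type*} [NormedAddCommGroup E] [NormedSpace ℝ E]
    [CompleteSpace E] {z g : ℝ → E} (hz : ∀ T, 0 ≤ T → AbsolutelyContinuousOnInterval z 0 T)
    (hg : ContinuousOn g (Set.Ici 0)) (hd : ∀ᵐ t, 0 < t → HasDerivAt z (g t) t) {t : ℝ}
    (ht : 0 < t) : HasDerivAt z (g t) t := by
  -- Constant extension to negative times gives a continuous function on ℝ, hence a C¹ primitive I;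
  -- z - I is absolutely continuous with derivative zero almost everywhere, so constant.
  set g' : ℝ → E := fun t => g (max t 0) with hg'
  have hgc : Continuous g' := by
    rw [hg', ← continuousOn_univ]
    exact hg.comp (continuous_id.max continuous_const).continuousOn fun s _ => le_max_right s 0
  have hgeq : ∀ s, 0 < s → g' s = g s := fun s hs => by simp [hg', max_eq_left hs.le]
  set I : ℝ → E := fun t => ∫ s in (0 : ℝ)..t, g' s with hI
  have hId : ∀ s, HasDerivAt I (g' s) s := fun s => (hgc.integral_hasStrictDerivAt 0 s).hasDerivAt
  have hI1 : ContDiff ℝ 1 I := by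
    refine contDiff_one_iff_deriv.2 ⟨fun s => (hId s).differentiableAt, ?_⟩
    rw [funext fun s => (hId s).deriv]
    exact hgc
  have hT : (0 : ℝ) ≤ t + 1 := by linarith
  obtain ⟨C, hC⟩ := ((hz (t + 1) hT).sub
    hI1.contDiffOn.absolutelyContinuousOnInterval).const_of_ae_hasDerivAt_zero (by
      have h0 : ∀ᵐ s : ℝ, s ≠ 0 := by simp [ae_iff, measure_singleton]
      filter_upwards [hd, h0] with s hs hs0 hmem
      rw [Set.uIcc_of_le hT] at hmem
      have hpos : 0 < s := lt_of_le_of_ne hmem.1 hs0.symm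
      have := (hs hpos).sub (hId s)
      rwa [hgeq s hpos, sub_self] at this)
  have hev : z =ᶠ[𝓝 t] fun s => C + I s := by
    filter_upwards [Ioo_mem_nhds ht (lt_add_one t)] with s hs
    have := hC s (by rw [Set.uIcc_of_le hT]; exact ⟨hs.1.le, hs.2.le⟩)
    rw [Pi.sub_apply] at this
    rw [← this]; abel
  have := ((hId t).const_add C).congr_of_eventuallyEq hev
  rwa [hgeq t ht] at this

theorem ae_hasDerivAt_integral_of_pos {k : ℝ → ℝ}
    (hk : ∀ T, 0 ≤ T → IntervalIntegrable k volume 0 T) :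
    ∀ᵐ t, 0 < t → HasDerivAt (fun t => ∫ s in (0 : ℝ)..t, k s) (k t) t := by
  have h : ∀ᵐ t, ∀ m : ℕ, t ∈ Set.uIcc (0 : ℝ) m → ∀ c ∈ Set.uIcc (0 : ℝ) m,
      HasDerivAt (fun t => ∫ s in c..t, k s) (k t) t :=
    ae_all_iff.2 fun m => (hk m m.cast_nonneg).ae_hasDerivAt_integral
  filter_upwards [h] with t ht hpos
  obtain ⟨m, hm⟩ := exists_nat_ge t
  refine ht m ?_ 0 (by simp)
  rw [Set.uIcc_of_le m.cast_nonneg]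
  exact ⟨hpos.le, hm⟩

/-! ### Reduction of the input delay -/

/-- The distributed input `∫_{t-h}^{t} e^{A(t-h-s)} B (u s) ds` is, for `t ≥ 0`, the product of an
exponential with an absolutely continuous function, and is differentiable almost everywhere. -/
theorem exists_absolutelyContinuous_eq_integral_exp_mulVec {n : ℕ}
    (A B : Matrix (Fin n) (Fin n) ℝ) {h : ℝ} (hh : 0 < h) {u : ℝ → Fin n → ℝ}
    (hu : ∀ T, 0 ≤ T → IntervalIntegrable u volume (-h) T) :
    ∃ J : ℝ → Fin n → ℝ, (∀ T, 0 ≤ T → AbsolutelyContinuousOnInterval J 0 T) ∧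
      (∀ t, 0 ≤ t →
        ∫ s in (t - h)..t, (NormedSpace.exp ((t - h - s) • A) * B).mulVec (u s) = J t) ∧
      ∀ᵐ t, 0 < t → HasDerivAt J (A.mulVec (J t) +
        ((NormedSpace.exp (-(h • A)) * B).mulVec (u t) - B.mulVec (u (t - h)))) t := by
  -- Splitting e^{A(t-h-s)} = e^{A(t-h)} e^{-As} takes t out of the integrand.
  set f : ℝ → Fin n → ℝ := fun s => (NormedSpace.exp ((-s) • A) * B).mulVec (u s) with hf
  have hfint : ∀ T, 0 ≤ T → IntervalIntegrable f volume (-h) T := fun T hT =>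
    (hu T hT).matrix_mulVec
      (((continuous_exp_smul A).comp continuous_neg).matrix_mul continuous_const)
  have hsub : ∀ a b, -h ≤ a → -h ≤ b → IntervalIntegrable f volume a b := by
    intro a b ha hb
    have hm : (0 : ℝ) ≤ max (max a b) 0 := le_max_right _ _
    refine (hfint _ hm).mono_set (Set.uIcc_subset_uIcc ?_ ?_) <;>
      rw [Set.uIcc_of_le (by linarith)]
    · exact ⟨ha, (le_max_left a b).trans (le_max_left _ _)⟩
    · exact ⟨hb, (le_max_right a b).trans (le_max_left _ _)⟩
  -- The moving window becomes a primitive: its integral of f is c + ∫₀ᵗ k.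
  set k : ℝ → Fin n → ℝ := fun s => f s - f (s - h) with hk
  have hshift : ∀ T, 0 ≤ T → IntervalIntegrable (fun s => f (s - h)) volume 0 T := by
    intro T hT
    have := (hsub (-h) (T - h) le_rfl (by linarith)).comp_sub_right h
    simpa using this
  have hkint : ∀ T, 0 ≤ T → IntervalIntegrable k volume 0 T := fun T hT =>
    (hsub 0 T (by linarith) (by linarith)).sub (hshift T hT)
  set c : Fin n → ℝ := ∫ s in (-h)..0, f s with hc
  set Q : ℝ → Fin n → ℝ := fun t i => c i + ∫ s in (0 : ℝ)..t, k s i with hQ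
  have hQeq : ∀ t, 0 ≤ t → ∫ s in (t - h)..t, f s = Q t := by
    intro t ht
    ext i
    have h1 : ∫ s in (0 : ℝ)..t, k s = (∫ s in (0 : ℝ)..t, f s) - ∫ s in (-h)..(t - h), f s := by
      rw [hk, intervalIntegral.integral_sub (hsub 0 t (by linarith) (by linarith)) (hshift t ht),
        intervalIntegral.integral_comp_sub_right f h, zero_sub]
    have h2 : ∫ s in (t - h)..t, f s = c + ∫ s in (0 : ℝ)..t, k s := by
      rw [h1, hc, ← add_sub_assoc, intervalIntegral.integral_add_adjacent_intervals
          (hsub _ _ le_rfl (by linarith)) (hsub _ _ (by linarith) (by linarith)),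
        intervalIntegral.integral_interval_sub_left
          (hsub _ _ le_rfl (by linarith)) (hsub _ _ le_rfl (by linarith))]
    rw [h2, Pi.add_apply, intervalIntegral_apply (hkint t ht)]
  have hexp : ∀ t s : ℝ, NormedSpace.exp ((t - h) • A) * NormedSpace.exp ((-s) • A) =
      NormedSpace.exp ((t - h - s) • A) := by
    intro t s
    rw [← Matrix.exp_add_of_commute _ _
      (((Commute.refl A).smul_left _).smul_right _), ← add_smul, ← sub_eq_add_neg]
  have hfexp : ∀ t s, (NormedSpace.exp ((t - h) • A)).mulVec (f s) =
      (NormedSpace.exp ((t - h - s) • A) * B).mulVec (u s) := by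
    intro t s
    rw [hf, Matrix.mulVec_mulVec, ← Matrix.mul_assoc, hexp]
  have hM : ∀ i j t, HasDerivAt (fun t : ℝ => NormedSpace.exp ((t - h) • A) i j)
      ((A * NormedSpace.exp ((t - h) • A)) i j) t := fun i j t =>
    (hasDerivAt_exp_smul_apply A i j (t - h)).comp_sub_const
  refine ⟨fun t => (NormedSpace.exp ((t - h) • A)).mulVec (Q t), fun T hT => ?_,
    fun t ht => ?_, ?_⟩
  · refine AbsolutelyContinuousOnInterval.matrix_mulVec (fun j => ?_) fun j => ?_
    · exact (contDiff_pi.2 fun i => (contDiff_exp_smul_apply A i j).comp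
        (contDiff_id.sub contDiff_const)).contDiffOn.absolutelyContinuousOnInterval
    · exact (LipschitzWith.const (c j)).lipschitzOnWith.absolutelyContinuousOnInterval.fun_add
        (((hkint T hT).eval j).absolutelyContinuousOnInterval_intervalIntegral (by simp))
  · simp only [← hfexp]
    rw [← hQeq t ht]
    exact ((NormedSpace.exp ((t - h) • A)).mulVecLin.toContinuousLinearMap).intervalIntegral_comp_comm
      (hsub _ _ (by linarith) (by linarith))
  · have hae : ∀ᵐ t, ∀ i, 0 < t → HasDerivAt (fun t => ∫ s in (0 : ℝ)..t, k s i) (k t i) t :=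
      ae_all_iff.2 fun i => ae_hasDerivAt_integral_of_pos fun T hT => (hkint T hT).eval i
    filter_upwards [hae] with t ht hpos
    have hQd : HasDerivAt Q (k t) t := hasDerivAt_pi.2 fun i => (ht i hpos).const_add _
    refine (HasDerivAt.matrix_mulVec (fun i j => hM i j t) hQd).congr_deriv ?_
    simp only [hk, Matrix.mulVec_sub, hfexp, Matrix.mulVec_mulVec]
    simp

/-- A delayed control system is reduced to an undelayed one by adding the distributed input to
its state. -/
theorem memoryState_hasDerivAt {N n : ℕ} {A : Matrix (Fin n) (Fin n) ℝ} {σ h : ℝ} (hh : 0 < h)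
    {x u : Fin N → ℝ → Fin n → ℝ} (hdyn : IsOpinionDynamics A σ h x u) (i : Fin N) :
    ContinuousOn (memoryState A σ h x u i) (Set.Ici 0) ∧
      (ContinuousOn (u i) (Set.Ici 0) → ∀ t, 0 < t → HasDerivAt (memoryState A σ h x u i)
        (A.mulVec (memoryState A σ h x u i t) + (effectiveInputMatrix A σ h).mulVec (u i t)) t) := by
  obtain ⟨J, hJac, hJeq, hJd⟩ := exists_absolutelyContinuous_eq_integral_exp_mulVec A (1 - A) hh
    (hdyn.input_integrable i)
  have hac : ∀ T, 0 ≤ T → AbsolutelyContinuousOnInterval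
      (fun t => x i t + (1 - σ) • J t) 0 T := fun T hT =>
    (hdyn.absolutelyContinuous i T hT).fun_add ((hJac T hT).const_smul (1 - σ))
  have heq : ∀ t, 0 ≤ t → memoryState A σ h x u i t = x i t + (1 - σ) • J t := by
    intro t ht
    rw [memoryState, hJeq t ht]
  have hcont : ContinuousOn (memoryState A σ h x u i) (Set.Ici 0) := by
    intro t ht
    have ht : 0 ≤ t := ht
    have h1 : ContinuousOn (memoryState A σ h x u i) (Set.Icc 0 (t + 1)) := by
      have h2 := (hac (t + 1) (by linarith)).continuousOn
      rw [Set.uIcc_of_le (by linarith)] at h2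
      exact h2.congr fun s hs => heq s hs.1
    refine (h1 t ⟨ht, by linarith⟩).mono_of_mem_nhdsWithin ?_
    rw [← Set.Ici_inter_Iic]
    exact inter_mem_nhdsWithin _ (Iic_mem_nhds (lt_add_one t))
  refine ⟨hcont, fun hu t ht => ?_⟩
  have hd : ∀ᵐ t, 0 < t → HasDerivAt (fun t => x i t + (1 - σ) • J t)
      (A.mulVec (memoryState A σ h x u i t) + (effectiveInputMatrix A σ h).mulVec (u i t)) t := by
    filter_upwards [hJd, (ae_restrict_iff' measurableSet_Ici).1 (hdyn.deriv_eq i)] with s hs hx hpos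
    -- The two terms in u(t - h) cancel here.
    refine ((hx hpos.le).add ((hs hpos).const_smul (1 - σ))).congr_deriv ?_
    rw [heq s hpos.le, effectiveInputMatrix, Matrix.mulVec_add, Matrix.mulVec_smul,
      Matrix.add_mulVec, Matrix.smul_mulVec, Matrix.smul_mulVec, smul_add, smul_sub]
    abel
  refine (hasDerivAt_of_ae_hasDerivAt hac ?_ hd ht).congr_of_eventuallyEq ?_
  · exact ((Continuous.matrix_mulVec continuous_const continuous_id).comp_continuousOn hcont).add
      ((Continuous.matrix_mulVec continuous_const continuous_id).comp_continuousOn hu)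
  · filter_upwards [Ioi_mem_nhds ht] with s hs using heq s (le_of_lt hs)

open scoped Matrix.Norms.Operator in
/-- The distributed effect of a vanishing input vanishes. -/
theorem tendsto_integral_exp_mulVec_zero {n : ℕ} (A B : Matrix (Fin n) (Fin n) ℝ) {h : ℝ}
    (hh : 0 < h) {u : ℝ → Fin n → ℝ} (hu : Tendsto u atTop (𝓝 0)) :
    Tendsto (fun t => ∫ s in (t - h)..t, (NormedSpace.exp ((t - h - s) • A) * B).mulVec (u s))
      atTop (𝓝 0) := by
  have hcont : Continuous fun s : ℝ => NormedSpace.exp (s • A) * B :=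
    (continuous_exp_smul A).matrix_mul continuous_const
  obtain ⟨C, hC⟩ := (isCompact_Icc (a := -h) (b := 0)).exists_bound_of_continuousOn
    hcont.continuousOn
  have hC0 : 0 ≤ C := (norm_nonneg _).trans (hC 0 ⟨by linarith, le_rfl⟩)
  rw [Metric.tendsto_atTop]
  intro ε hε
  -- C + 1 replaces C, which may be zero.
  obtain ⟨T, hT⟩ := Metric.tendsto_atTop.1 hu (ε / ((C + 1) * h)) (by positivity)
  refine ⟨T + h, fun t ht => ?_⟩
  rw [dist_zero_right]
  have hb := intervalIntegral.norm_integral_le_of_norm_le_const (a := t - h) (b := t)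
    (C := C * (ε / ((C + 1) * h)))
    (f := fun s => (NormedSpace.exp ((t - h - s) • A) * B).mulVec (u s)) (by
      intro s hs
      rw [Set.uIoc_of_le (by linarith)] at hs
      have h1 := hT s (by linarith [hs.1])
      rw [dist_zero_right] at h1
      exact (Matrix.linfty_opNorm_mulVec _ _).trans (mul_le_mul
        (hC (t - h - s) ⟨by linarith [hs.2], by linarith [hs.1]⟩) h1.le (norm_nonneg _) hC0))
  refine hb.trans_lt ?_
  rw [sub_sub_cancel, abs_of_pos hh]
  have h2 : C * (ε / ((C + 1) * h)) * h = ε * (C / (C + 1)) := by field_simp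
  rw [h2]
  have h3 : C / (C + 1) < 1 := by rw [div_lt_one (by positivity)]; linarith
  nlinarith

/-! ### Consensus -/

theorem corollary1 {N n : ℕ} (G : SignedDigraph N)
    (A F : Matrix (Fin n) (Fin n) ℝ) (σ h : ℝ)
    (hσ0 : 0 ≤ σ) (hσ1 : σ ≤ 1) (hh : 0 < h)
    (hG : G.unsigned.QuasiStronglyConnected)
    (hA : A ∈ marginallyStableMatrices n)
    (hF : ∀ l ∈ G.unsigned.otherEigenvalues,
      IsHurwitz (A.map (algebraMap ℝ ℂ) -
        l • (effectiveInputMatrix A σ h * F).map (algebraMap ℝ ℂ)))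
    (x u : Fin N → ℝ → Fin n → ℝ)
    (hdyn : IsOpinionDynamics A σ h x u)
    (hrule : FollowsMemoryRule G.unsigned A F σ h x u) :
    ReachesConsensus x := by
  obtain ⟨r, hr⟩ := hG
  have hrule' : ∀ i t, 0 ≤ t → u i t =
      -F.mulVec (∑ j, G.unsigned.laplacian i j • memoryState A σ h x u j t) := by
    intro i t ht
    rw [hrule i t ht, G.sum_laplacian_smul fun j => memoryState A σ h x u j t, Matrix.mulVec_neg]
  -- Not circular: z is continuous for merely integrable inputs, the rule then makes u continuous,
  -- and only then does the equation for z hold at every t > 0.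
  have hucont : ∀ i, ContinuousOn (u i) (Set.Ici 0) := by
    intro i
    refine ContinuousOn.congr ?_ (hrule' i)
    refine ((Continuous.matrix_mulVec continuous_const continuous_id).comp_continuousOn
      (continuousOn_finsetSum _ fun j _ => ?_)).neg
    exact (memoryState_hasDerivAt hh hdyn j).1.const_smul (G.unsigned.laplacian i j)
  have hLz := tendsto_laplacian_smul_zero G A (effectiveInputMatrix A σ h * F) hF
    (z := memoryState A σ h x u) fun i t ht => by
      refine ((memoryState_hasDerivAt hh hdyn i).2 (hucont i) t ht).congr_deriv ?_
      rw [hrule' i t ht.le, Matrix.mulVec_neg, Matrix.mulVec_mulVec, ← sub_eq_add_neg]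
  have hu : ∀ i, Tendsto (u i) atTop (𝓝 0) := by
    intro i
    have h1 := (tendsto_mulVec_zero F (hLz i)).neg
    rw [neg_zero] at h1
    refine h1.congr' ?_
    filter_upwards [eventually_ge_atTop 0] with t ht using (hrule' i t ht).symm
  have hz : ∀ i, Tendsto
      (fun t => memoryState A σ h x u i t - memoryState A σ h x u r t) atTop (𝓝 0) := by
    intro i
    obtain ⟨c, hc⟩ := G.exists_sub_eq_sum_laplacian hr i
    have h1 : Tendsto (fun t => ∑ k, c k • ∑ j, G.unsigned.laplacian k j •
        memoryState A σ h x u j t) atTop (𝓝 0) := by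
      simpa using tendsto_finsetSum Finset.univ fun k _ => (hLz k).const_smul (c k)
    refine h1.congr fun t => ?_
    ext m
    rw [Pi.sub_apply, hc fun j => memoryState A σ h x u j t m]
    simp [Matrix.mulVec, dotProduct]
  have hxz : ∀ i, Tendsto (fun t => memoryState A σ h x u i t - x i t) atTop (𝓝 0) := by
    intro i
    simpa [memoryState] using
      (tendsto_integral_exp_mulVec_zero A (1 - A) hh (hu i)).const_smul (1 - σ)
  refine ⟨x r, fun i => ?_⟩
  have h1 := ((hz i).sub (hxz i)).add (hxz r)
  rw [sub_zero, add_zero] at h1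
  refine h1.congr fun t => ?_
  abel
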